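/- For $k<n<\omega$ let $S^n_k=\{\alpha<\omega_n:\operatorname{cf}\alpha=\omega_k\}$. A set $S\subseteq\omega_3$ reflects at $\gamma<\omega_3$ if $S\cap\gamma$ is a stationary subset of $\gamma$; the trace $\operatorname{Tr}(S)$ is the set of all $\gamma<\omega_3$ at which $S$ reflects. Proposition 3.3. There are a stationary subset $A$ of $\omega_3$ with $A\subseteq S^3_1$, and stationary subsets $S_i$ $(i<\omega_1)$ of $\omega_3$ with $S_i\subseteq S^3_0$, such that $\operatorname{Tr}(S_i)\cap A=\emptyset$ for each $i<\omega_1$, but $\operatorname{Tr}\bigl(\bigcup_{i<\omega_1}S_i\bigr)\supseteq A$. -/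

import Mathlib

universe u

open scoped Cardinal Ordinal

namespace StationaryReflection

/-- `S ∩ γ` is a stationary subset of the ordinal `γ` (identified with the well-order
`Set.Iio γ` of its predecessors): it meets every closed unbounded subset of `γ`. -/
def IsStationaryIn (S : Set Ordinal.{u}) (γ : Ordinal.{u}) : Prop :=
  IsStationary ((Subtype.val : Set.Iio γ → Ordinal.{u}) ⁻¹' S)

/-- `S^n_k = {α < ω_n : cf α = ω_k}`. -/
def cofSet (n k : ℕ) : Set Ordinal.{u} :=
  {α | α < ω_ (n : Ordinal.{u}) ∧ α.cof = ℵ_ (k : Ordinal.{u})}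

/-- The trace of a subset `S` of `κ`: the set of all `γ < κ` at which `S` reflects, that is, such
that `S ∩ γ` is a stationary subset of `γ`. -/
def trace (κ : Ordinal.{u}) (S : Set Ordinal.{u}) : Set Ordinal.{u} :=
  {γ | γ < κ ∧ IsStationaryIn S γ}

end StationaryReflection

/-! Take `κ = ℵ_ 2`, `μ = ℵ_ 1`, `ν = ℵ_ 0` and functions `h β : κ → κ`, for `β < κ⁺`, increasing
modulo bounded sets. Each `γ` of cofinality `μ` has a club of size `μ` on which `β ↦ h β ξ` is
strictly increasing for one `ξ < κ`, with a supremum `η < κ` (`exists_strictMono_on_club`). There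
are only `κ` pairs `(ξ, η)`, so one pair serves a stationary set `A`. Split the points of cofinality
`ν` with `h β ξ < η` by bounds `η_i`, `i < μ`, cofinal in `η`. Below `γ ∈ A` the values on the club
climb to `η`: a tail of the club avoids each piece, yet the union contains all its points of
cofinality `ν`. -/

section

open Cardinal Order Set

/-! ### Small clubs in well-orders -/

namespace Order

variable {α : Type*} [LinearOrder α]

/-- A well-order without maximum has a club set whose cardinality is the cofinality. -/
theorem exists_isClub_mk_le_cof [WellFoundedLT α] [NoMaxOrder α] :
    ∃ c : Set α, IsClub c ∧ #c ≤ cof α := by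
  obtain ⟨d, hd, hdc⟩ := exists_cof_eq α
  have above (a : α) : ∃ x : d, a < x := by
    obtain ⟨b, hb⟩ := exists_gt a
    obtain ⟨x, hx, hbx⟩ := hd b
    exact ⟨⟨x, hx⟩, hb.trans_le hbx⟩
  -- The closure of `d`, together with the least element.
  refine ⟨{a | ∀ b < a, ∃ x ∈ d, b < x ∧ x ≤ a}, ⟨?_, ?_⟩, ?_⟩
  · intro t ht _ _ a ha b hb
    obtain ⟨y, hy, hby⟩ := (lt_isLUB_iff ha).1 hb
    obtain ⟨x, hx, hbx, hxy⟩ := ht hy b hby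
    exact ⟨x, hx, hbx, hxy.trans (ha.1 hy)⟩
  · intro a
    obtain ⟨x, hx, hax⟩ := hd a
    exact ⟨x, fun b hb ↦ ⟨x, hx, hb, le_rfl⟩, hax⟩
  · rw [← hdc]
    let next (a : α) : d := wellFounded_lt.min {x : d | a < x} (above a)
    have lt_next (a : α) : a < next a := wellFounded_lt.min_mem {x : d | a < x} (above a)
    have next_le {a : α} {x : d} (h : a < x) : next a ≤ x :=
      wellFounded_lt.min_le (s := {x : d | a < x}) h
    have hmono : StrictMonoOn next {a | ∀ b < a, ∃ x ∈ d, b < x ∧ x ≤ a} := by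
      intro a _ b hb hab
      obtain ⟨x, hx, hax, hxb⟩ := hb a hab
      exact Subtype.coe_lt_coe.1 <|
        (Subtype.coe_le_coe.2 (next_le (x := ⟨x, hx⟩) hax)).trans_lt (hxb.trans_lt (lt_next b))
    exact mk_le_of_injective hmono.injOn.injective

end Order

theorem IsClub.inter_Ici {α : Type*} [LinearOrder α] {s : Set α} (hs : IsClub s) (a : α) :
    IsClub (s ∩ Ici a) := by
  refine ⟨fun t ht ht₀ _ b hb ↦ ⟨hs.isLUB_mem (ht.trans inter_subset_left) ht₀ hb, ?_⟩, fun b ↦ ?_⟩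
  · obtain ⟨x, hx⟩ := ht₀
    exact (ht hx).2.trans (hb.1 hx)
  · obtain ⟨x, hx, hbx⟩ := hs.isCofinal (max a b)
    exact ⟨x, ⟨hx, (le_max_left _ _).trans hbx⟩, (le_max_right _ _).trans hbx⟩

/-! ### Cofinality and stationary sets of ordinals -/

namespace Ordinal

theorem exists_lt_forall_lt_of_lt_cof {ι : Type (u + 1)} {f : ι → Ordinal.{u}} {a : Ordinal.{u}}
    (hι : #ι < Cardinal.lift.{u + 1} a.cof) (hf : ∀ i, f i < a) : ∃ b < a, ∀ i, f i < b := by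
  have hs : ∀ x ∈ range f, x < a := forall_mem_range.2 hf
  refine ⟨_, sSup_add_one_lt_of_lt_cof (by simpa using mk_range_le.trans_lt hι) hs, fun i ↦ ?_⟩
  refine (lt_add_one (f i)).trans_le (le_csSup ⟨a, ?_⟩ ⟨f i, mem_range_self i, rfl⟩)
  rintro _ ⟨x, hx, rfl⟩
  exact Order.add_one_le_of_lt (hs x hx)

theorem noMaxOrder_Iio {a : Ordinal.{u}} (ha : IsSuccLimit a) : NoMaxOrder (Iio a) where
  exists_gt b := ⟨⟨_, ha.succ_lt b.2⟩, Order.lt_succ b.1⟩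

/-- The points of cofinality `μ` form a stationary subset of any ordinal of cofinality above `μ`. -/
theorem isStationary_setOf_cof_eq {γ : Ordinal.{u}} {μ : Cardinal.{u}} (hμ : μ.IsRegular)
    (hγ : μ < γ.cof) : IsStationary {x : Iio γ | x.1.cof = μ} := by
  intro C hC
  have hle : lift.{u + 1} μ.ord < typeLT C := by
    refine (?_ : _ < (Order.cof C).ord).trans_le ?_
    · rw [cof_eq_of_isCofinal hC.isCofinal, cof_Iio, ← lift_cof, lift_ord, ord_lt_ord]
      exact Cardinal.lift_lt.2 hγ
    · rw [← cof_type]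
      exact ord_cof_le _
  -- The first `μ` elements of `C`: their supremum is in `C` and has cofinality `μ`.
  let f (i : Iio μ.ord) : C := enum (α := C) (· < ·) ⟨lift.{u + 1} i.1, (lift_lt.2 i.2).trans hle⟩
  have hf : StrictMono f := fun i j hij ↦
    (enum (α := C) (· < ·)).map_rel_iff.2 (lift_lt.2 hij)
  have hf' : StrictMono fun i ↦ (f i).1.1 := fun i j hij ↦ hf hij
  obtain ⟨b, hb, hfb⟩ := exists_lt_forall_lt_of_lt_cof (f := fun i ↦ (f i).1.1) (a := γ)
    (by rw [Cardinal.mk_Iio_ordinal, card_ord]; exact Cardinal.lift_lt.2 hγ) fun i ↦ (f i).1.2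
  have : Nonempty (Iio μ.ord) := ⟨⟨0, hμ.ord_pos⟩⟩
  have hbdd : BddAbove (range fun i ↦ (f i).1.1) := ⟨b, forall_mem_range.2 fun i ↦ (hfb i).le⟩
  have hlt : ⨆ i, (f i).1.1 < γ := (ciSup_le fun i ↦ (hfb i).le).trans_lt hb
  refine ⟨⟨_, hlt⟩, ?_, hC.isLUB_mem (t := range fun i ↦ (f i).1) ?_ (range_nonempty _) ⟨?_, ?_⟩⟩
  · have := cof_iSup_Iio hf' (isSuccLimit_ord hμ.aleph0_le).isSuccPrelimit
    rwa [hμ.cof_ord] at this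
  · exact range_subset_iff.2 fun i ↦ (f i).2
  · exact forall_mem_range.2 fun i ↦ le_ciSup hbdd i
  · exact fun x hx ↦ Subtype.coe_le_coe.1 <| ciSup_le fun i ↦
      Subtype.coe_le_coe.2 (hx (mem_range_self i))

theorem isRegularCardinalOrder_Iio {κ : Cardinal.{u}} (hκ : κ.IsRegular) :
    IsRegularCardinalOrder (Iio κ.ord) where
  type_lt_le_ord_cof := by
    rw [cof_Iio, ← lift_cof, hκ.cof_ord, ← lift_ord]
    exact (type_lt_Iio κ.ord).le

/-- The trace of a club set on an ordinal in which it is cofinal is a club set. -/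
theorem isClub_preimage_inclusion {γ κ : Ordinal.{u}} (hγ : γ ≤ κ) {C : Set (Iio κ)}
    (hC : IsClub C) (hcof : IsCofinal (inclusion (Iio_subset_Iio hγ) ⁻¹' C)) :
    IsClub (inclusion (Iio_subset_Iio hγ) ⁻¹' C) := by
  refine ⟨fun t ht ht₀ _ a ha ↦ ?_, hcof⟩
  refine hC.isLUB_mem (t := inclusion (Iio_subset_Iio hγ) '' t) (image_subset_iff.2 ht)
    (ht₀.image _) ⟨forall_mem_image.2 fun x hx ↦ ha.1 hx, fun b hb ↦ ?_⟩
  by_contra! hba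
  have hb' : b.1 < γ := lt_trans (b := a.1) hba a.2
  have : a ≤ ⟨b, hb'⟩ := ha.2 fun x hx ↦ hb (mem_image_of_mem (inclusion (Iio_subset_Iio hγ)) hx)
  exact this.not_gt hba

open StationaryReflection in
/-- A set reflecting at stationarily many points of a regular uncountable cardinal is stationary. -/
theorem isStationaryIn_of_subset_trace {κ : Cardinal.{u}} (hκ : κ.IsRegular) (hκ₀ : ℵ₀ < κ)
    {A S : Set Ordinal.{u}} (hA : IsStationaryIn A κ.ord) (hS : A ⊆ trace κ.ord S) :
    IsStationaryIn S κ.ord := by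
  intro C hC
  have := isRegularCardinalOrder_Iio hκ
  have hcof : Order.cof (Iio κ.ord) ≠ ℵ₀ := by
    rw [cof_Iio, ← lift_cof, hκ.cof_ord]
    exact (aleph0_lt_lift.2 hκ₀).ne'
  have he := hC.isNormal_enum
  -- If `γ` is a fixed point of the enumeration of `C`, then `C` is cofinal in `γ`.
  obtain ⟨γ, hγA, hγ⟩ := hA (he.isClub_fixedPoints hcof)
  obtain ⟨x, hxS, hxC⟩ := (hS hγA).2 <| isClub_preimage_inclusion γ.2.le hC fun a ↦ by
    let b : Iio κ.ord := ⟨a.1, lt_trans (b := γ.1) a.2 γ.2⟩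
    have hb : (Order.enum C hC.isCofinal b).1 < γ := by
      conv_rhs => rw [← hγ.eq]
      exact he.strictMono (show b < γ from a.2)
    exact ⟨⟨_, hb⟩, (Order.enum C hC.isCofinal b).2, he.strictMono.le_apply (x := b)⟩
  exact ⟨_, hxS, hxC⟩

/-! ### Functions increasing modulo bounded sets -/

theorem lt_ord_succ_iff {κ : Cardinal.{u}} {β : Ordinal.{u}} :
    β < (succ κ).ord ↔ β.card ≤ κ := by
  rw [lt_ord, lt_succ_iff]

/-- Given bounds `g` on the ordinals below `β`, the pointwise least sequence of functions such that
the `β`-th one exceeds the `α`-th one at every argument above `g β α`. -/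
noncomputable def diagonalSup (g : ∀ β : Ordinal.{u}, Iio β → Ordinal.{u}) :
    Ordinal.{u} → Ordinal.{u} → Ordinal.{u}
  | β, ξ => ⨆ α : {α : Iio β // g β α < ξ}, diagonalSup g α.1.1 ξ + 1
termination_by β => β
decreasing_by exact α.1.2

/-- For regular `κ`, there is a `κ⁺`-sequence of functions `κ → κ` that increases modulo bounded
sets. -/
theorem exists_increasing_modulo_bounded {κ : Cardinal.{u}} (hκ : κ.IsRegular) :
    ∃ h : Ordinal.{u} → Ordinal.{u} → Ordinal.{u},
      (∀ β < (succ κ).ord, ∀ ξ < κ.ord, h β ξ < κ.ord) ∧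
      ∀ β < (succ κ).ord, ∀ α < β, ∃ ζ < κ.ord, ∀ ξ < κ.ord, ζ < ξ → h α ξ < h β ξ := by
  have hg (β : Ordinal.{u}) : ∃ g : Iio β → Ordinal.{u},
      β < (succ κ).ord → g.Injective ∧ ∀ α, g α < κ.ord := by
    by_cases hβ : β < (succ κ).ord
    · have : #(Iio β) ≤ #(Iio κ.ord) := by
        rw [Cardinal.mk_Iio_ordinal, Cardinal.mk_Iio_ordinal, card_ord]
        exact Cardinal.lift_le.2 (lt_ord_succ_iff.1 hβ)
      obtain ⟨e⟩ := this
      exact ⟨fun α ↦ (e α).1, fun _ ↦ ⟨Subtype.val_injective.comp e.injective, fun α ↦ (e α).2⟩⟩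
    · exact ⟨0, fun h ↦ (hβ h).elim⟩
  choose g hg using hg
  refine ⟨diagonalSup g, fun β ↦ ?_, fun β hβ α hα ↦ ?_⟩
  · induction β using WellFoundedLT.induction with | ind β ih =>
    intro hβ ξ hξ
    -- `g β` injects the index set into `ξ`, so the supremum has fewer than `κ` terms.
    have hι : #{α : Iio β // g β α < ξ} < Cardinal.lift.{u + 1} κ.ord.cof := by
      have : #{α : Iio β // g β α < ξ} ≤ #(Iio ξ) :=
        mk_le_of_injective (f := fun α ↦ (⟨g β α.1, α.2⟩ : Iio ξ)) fun α α' h ↦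
          Subtype.ext ((hg β hβ).1 (Subtype.ext_iff.1 h))
      refine this.trans_lt ?_
      rw [Cardinal.mk_Iio_ordinal, hκ.cof_ord]
      exact Cardinal.lift_lt.2 (lt_ord.1 hξ)
    obtain ⟨b, hb, hlt⟩ := exists_lt_forall_lt_of_lt_cof hι
      fun α ↦ ih α.1.1 α.1.2 (α.1.2.trans hβ) ξ hξ
    rw [diagonalSup]
    exact (Ordinal.iSup_le fun α ↦ Order.add_one_le_of_lt (hlt α)).trans_lt hb
  · refine ⟨g β ⟨α, hα⟩, (hg β hβ).2 _, fun ξ _ hζ ↦ ?_⟩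
    rw [diagonalSup.eq_def g β]
    exact (lt_add_one _).trans_le <| le_ciSup
      (f := fun α : {α : Iio β // g β α < ξ} ↦ diagonalSup g α.1.1 ξ + 1)
      bddAbove_of_small ⟨⟨α, hα⟩, hζ⟩

/-- For `γ` of cofinality `μ < κ`, a sequence of functions `κ → κ` that increases modulo bounded sets
is, at a single argument, strictly increasing on a club subset of `γ` of cardinality `μ`. -/
theorem exists_strictMono_on_club {κ μ : Cardinal.{u}} (hκ : κ.IsRegular) (hμ : μ.IsRegular)
    (hμκ : μ < κ) {γ : Ordinal.{u}} {h : Ordinal.{u} → Ordinal.{u} → Ordinal.{u}}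
    (hlt : ∀ β < γ, ∀ ξ < κ.ord, h β ξ < κ.ord)
    (hinc : ∀ β < γ, ∀ α < β, ∃ ζ < κ.ord, ∀ ξ < κ.ord, ζ < ξ → h α ξ < h β ξ)
    (hγ : γ.cof = μ) :
    ∃ ξ < κ.ord, ∃ η < κ.ord, ∃ s : Iio μ.ord → Iio γ, IsClub (range s) ∧
      (∀ i j, s i < s j → h (s i) ξ < h (s j) ξ) ∧ (∀ i, h (s i) ξ < η) ∧
      ∀ y < η, ∃ i, y < h (s i) ξ := by
  have hγl : IsSuccLimit γ := by
    rw [← one_lt_cof_iff, hγ]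
    exact hμ.nat_lt 1 |>.trans_eq' Nat.cast_one.symm
  have := noMaxOrder_Iio hγl
  have : Nonempty (Iio γ) := ⟨⟨0, hγl.bot_lt⟩⟩
  have hmk : #(Iio μ.ord) = Cardinal.lift.{u + 1} μ := by rw [Cardinal.mk_Iio_ordinal, card_ord]
  have hmkκ : #(Iio μ.ord) < Cardinal.lift.{u + 1} κ.ord.cof := by
    rw [hmk, hκ.cof_ord]
    exact Cardinal.lift_lt.2 hμκ
  obtain ⟨c, hc, hcard⟩ := exists_isClub_mk_le_cof (α := Iio γ)
  rw [cof_Iio, ← lift_cof, hγ, ← hmk] at hcard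
  obtain ⟨e⟩ := hcard
  have : Nonempty c := hc.nonempty.to_subtype
  -- Lists `c` in no particular order, possibly with repetitions.
  let s (i : Iio μ.ord) : Iio γ := (Function.invFun e i : c)
  have hs : range s = c := by
    ext x
    constructor
    · rintro ⟨i, rfl⟩
      exact Subtype.property _
    · exact fun hx ↦ ⟨e ⟨x, hx⟩, by simp [s, Function.leftInverse_invFun e.injective _]⟩
  rw [← hs] at hc
  have hζ (p : Iio μ.ord × Iio μ.ord) : ∃ ζ < κ.ord,
      s p.1 < s p.2 → ∀ ξ < κ.ord, ζ < ξ → h (s p.1) ξ < h (s p.2) ξ := by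
    by_cases hp : s p.1 < s p.2
    · obtain ⟨ζ, hζ, hζ'⟩ := hinc _ (s p.2).2 _ hp
      exact ⟨ζ, hζ, fun _ ↦ hζ'⟩
    · exact ⟨0, hκ.ord_pos, fun h ↦ (hp h).elim⟩
  choose ζ hζκ hζ using hζ
  -- Only `μ` many pairs occur, so regularity of `κ` puts one `ξ` above all thresholds.
  obtain ⟨ξ, hξ, hζξ⟩ := exists_lt_forall_lt_of_lt_cof (a := κ.ord) (f := ζ) (by
    rwa [mk_prod, Cardinal.lift_id, mul_eq_self]
    rw [hmk]
    exact aleph0_le_lift.2 hμ.aleph0_le) hζκ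
  have hmono (i j) (hij : s i < s j) : h (s i) ξ < h (s j) ξ := hζ (i, j) hij ξ hξ (hζξ _)
  have hsκ (i) : h (s i) ξ < κ.ord := hlt _ (s i).2 _ hξ
  obtain ⟨b, hb, hsb⟩ := exists_lt_forall_lt_of_lt_cof hmkκ hsκ
  have : Nonempty (Iio μ.ord) := ⟨⟨0, hμ.ord_pos⟩⟩
  have hbdd : BddAbove (range fun i ↦ h (s i) ξ) := ⟨b, forall_mem_range.2 fun i ↦ (hsb i).le⟩
  refine ⟨ξ, hξ, ⨆ i, h (s i) ξ, (ciSup_le fun i ↦ (hsb i).le).trans_lt hb, s, hc, hmono,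
    fun i ↦ ?_, fun y hy ↦ exists_lt_of_lt_ciSup hy⟩
  obtain ⟨x, hx⟩ := exists_gt (s i)
  obtain ⟨_, ⟨j, rfl⟩, hj⟩ := hc.isCofinal x
  exact (hmono i j (hx.trans_le hj)).trans_le (le_ciSup hbdd j)

end Ordinal

/-! ### The sets `A` and `S i` -/

namespace StationaryReflection

open Ordinal

theorem cof_Iio_ne_aleph0 {γ : Ordinal.{u}} (hγ : ℵ₀ < γ.cof) : Order.cof (Iio γ) ≠ ℵ₀ := by
  rw [cof_Iio, ← lift_cof]
  exact (aleph0_lt_lift.2 hγ).ne'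

/-- For regular cardinals `ν < μ < κ`, there are a stationary set `A` of points of cofinality `μ`
in `κ⁺` and `μ` many stationary sets of points of cofinality `ν`, none of which reflects at any
point of `A`, but whose union reflects at every point of `A`. -/
theorem exists_nonreflecting_iUnion_reflecting {κ μ ν : Cardinal.{u}} (hκ : κ.IsRegular)
    (hμ : μ.IsRegular) (hν : ν.IsRegular) (hνμ : ν < μ) (hμκ : μ < κ) :
    ∃ (A : Set Ordinal.{u}) (S : Iio μ.ord → Set Ordinal.{u}),
      A ⊆ {α | α < (succ κ).ord ∧ α.cof = μ} ∧
      IsStationaryIn A (succ κ).ord ∧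
      (∀ i, S i ⊆ {α | α < (succ κ).ord ∧ α.cof = ν} ∧ IsStationaryIn (S i) (succ κ).ord) ∧
      (∀ i, trace (succ κ).ord (S i) ∩ A = ∅) ∧
      A ⊆ trace (succ κ).ord (⋃ i, S i) := by
  have hκ' : (succ κ).IsRegular := isRegular_succ hκ.aleph0_le
  have hℵμ : ℵ₀ < μ := hν.aleph0_le.trans_lt hνμ
  have hℵκ : ℵ₀ < succ κ := hκ.aleph0_le.trans_lt (lt_succ κ)
  have hcofκ : Order.cof (Iio (succ κ).ord) ≠ ℵ₀ := cof_Iio_ne_aleph0 (by rwa [hκ'.cof_ord])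
  have hmkcof {θ : Cardinal.{u}} (hθ : θ ≤ κ) :
      #(Iio θ.ord) < Order.cof (Iio (succ κ).ord) := by
    rw [Cardinal.mk_Iio_ordinal, card_ord, cof_Iio, ← lift_cof, hκ'.cof_ord]
    exact Cardinal.lift_lt.2 (lt_succ_iff.2 hθ)
  obtain ⟨h, hlt, hinc⟩ := exists_increasing_modulo_bounded hκ
  let Q (γ ξ η : Ordinal.{u}) : Prop := ∃ s : Iio μ.ord → Iio γ, IsClub (range s) ∧
      (∀ i j, s i < s j → h (s i) ξ < h (s j) ξ) ∧ (∀ i, h (s i) ξ < η) ∧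
      ∀ y < η, ∃ i, y < h (s i) ξ
  obtain ⟨⟨ξ, η⟩, hA⟩ : ∃ p : Iio κ.ord × Iio κ.ord,
      IsStationary {γ : Iio (succ κ).ord | γ.1.cof = μ ∧ Q γ p.1 p.2} := by
    rw [← isStationary_iUnion_iff hcofκ]
    · refine (isStationary_setOf_cof_eq (γ := (succ κ).ord) hμ ?_).mono fun γ hγ ↦ ?_
      · rw [hκ'.cof_ord]
        exact hμκ.trans (lt_succ κ)
      · obtain ⟨ξ, hξ, η, hη, hQ⟩ := exists_strictMono_on_club hκ hμ hμκ
          (fun β hβ ↦ hlt β (hβ.trans γ.2)) (fun β hβ ↦ hinc β (hβ.trans γ.2)) hγ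
        exact mem_iUnion.2 ⟨(⟨ξ, hξ⟩, ⟨η, hη⟩), hγ, hQ⟩
    · rw [Cardinal.lift_lt, mk_prod, Cardinal.lift_id, mul_eq_self]
      · exact hmkcof le_rfl
      · rw [Cardinal.mk_Iio_ordinal, card_ord]
        exact aleph0_le_lift.2 hκ.aleph0_le
  let A : Set Ordinal.{u} := {γ | γ < (succ κ).ord ∧ γ.cof = μ ∧ Q γ ξ η}
  have hA : IsStationaryIn A (succ κ).ord := hA.mono fun γ hγ ↦ ⟨γ.2, hγ⟩
  -- Any single point of `A` supplies the bounds `h (s i) ξ`, cofinal in `η`.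
  obtain ⟨γ₀, -, -, s, -, -, hsη, hηs⟩ := hA.nonempty
  let T (i : Iio μ.ord) : Set Ordinal.{u} :=
    {β | β < (succ κ).ord ∧ β.cof = ν ∧ h β ξ ≤ h (s i) ξ}
  have hTA : A ⊆ trace (succ κ).ord (⋃ i, T i) := by
    rintro γ ⟨hγ, hγμ, t, ht, -, htη, -⟩
    refine ⟨hγ, fun C hC ↦ ?_⟩
    have hcof := cof_Iio_ne_aleph0 (hγμ ▸ hℵμ)
    obtain ⟨x, hxν, hxC, j, rfl⟩ :=
      isStationary_setOf_cof_eq hν (hγμ ▸ hνμ) (hC.inter hcof ht)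
    obtain ⟨i, hi⟩ := hηs _ (htη j)
    exact ⟨_, mem_iUnion.2 ⟨i, (t j).2.trans hγ, hxν, hi.le⟩, hxC⟩
  have hT := isStationaryIn_of_subset_trace hκ' hℵκ hA hTA
  rw [IsStationaryIn, preimage_iUnion, isStationary_iUnion_iff hcofκ
    (Cardinal.lift_lt.2 (hmkcof hμκ.le))] at hT
  obtain ⟨i₀, hi₀⟩ := hT
  have hTn (i) {γ : Ordinal.{u}} (hγ : γ ∈ A) : ¬ IsStationaryIn (T i) γ := by
    intro hst
    obtain ⟨-, -, t, ht, htm, -, htη⟩ := hγ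
    -- From `t j` on, the club `range t` has values above the bound defining `T i`.
    obtain ⟨j, hj⟩ := htη _ (hsη i)
    obtain ⟨_, ⟨-, -, hle⟩, ⟨k, rfl⟩, hk⟩ := hst (ht.inter_Ici (t j))
    refine (hle.trans_lt hj).not_ge ?_
    obtain hk | hk := eq_or_lt_of_le (mem_Ici.1 hk)
    · rw [hk]
    · exact (htm _ _ hk).le
  -- Some `T i` may be nonstationary; adding the stationary `T i₀` repairs this and creates no
  -- reflection in `A`.
  refine ⟨A, fun i ↦ T i ∪ T i₀, fun γ hγ ↦ ⟨hγ.1, hγ.2.1⟩, hA, fun i ↦ ⟨?_, ?_⟩, fun i ↦ ?_, ?_⟩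
  · exact union_subset (fun β hβ ↦ ⟨hβ.1, hβ.2.1⟩) fun β hβ ↦ ⟨hβ.1, hβ.2.1⟩
  · exact IsStationary.mono hi₀ (preimage_mono subset_union_right)
  · refine eq_empty_of_forall_notMem fun γ ⟨⟨_, hst⟩, hγ⟩ ↦ ?_
    rw [IsStationaryIn, preimage_union,
      isStationary_union_iff (cof_Iio_ne_aleph0 (hγ.2.1 ▸ hℵμ))] at hst
    exact hst.elim (hTn i hγ) (hTn i₀ hγ)
  · exact fun γ hγ ↦ ⟨(hTA hγ).1, (hTA hγ).2.mono <| preimage_mono <|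
      iUnion_mono fun i ↦ subset_union_left⟩

end StationaryReflection

end

theorem proposition3p3 :
    ∃ (A : Set Ordinal.{u}) (S : Set.Iio (ω_ 1 : Ordinal.{u}) → Set Ordinal.{u}),
      A ⊆ StationaryReflection.cofSet 3 1 ∧
      StationaryReflection.IsStationaryIn A (ω_ 3) ∧
      (∀ i, S i ⊆ StationaryReflection.cofSet 3 0 ∧
        StationaryReflection.IsStationaryIn (S i) (ω_ 3)) ∧
      (∀ i, StationaryReflection.trace (ω_ 3) (S i) ∩ A = ∅) ∧
      A ⊆ StationaryReflection.trace (ω_ 3) (⋃ i, S i) := by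
  have h2 : Order.succ (ℵ_ 1) = ℵ_ (2 : Ordinal.{u}) := by
    rw [Cardinal.succ_aleph, one_add_one_eq_two]
  have h3 : Order.succ (ℵ_ 2) = ℵ_ (3 : Ordinal.{u}) := by
    rw [Cardinal.succ_aleph, two_add_one_eq_three]
  have hreg : (ℵ_ (2 : Ordinal.{u})).IsRegular := h2 ▸ Cardinal.isRegular_succ (Cardinal.aleph0_le_aleph 1)
  have := StationaryReflection.exists_nonreflecting_iUnion_reflecting (ν := ℵ_ 0) hreg
    Cardinal.isRegular_aleph_one (Cardinal.aleph_zero ▸ Cardinal.isRegular_aleph0) (Cardinal.aleph_lt_aleph.2 zero_lt_one)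
    (h2 ▸ Order.lt_succ _)
  rw [Cardinal.ord_aleph 1] at this
  simpa only [h3, Cardinal.ord_aleph, StationaryReflection.cofSet, Nat.cast_ofNat, Nat.cast_one,
    Nat.cast_zero] using this
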